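/- Let $G$ be a finite group. A right action of $G$ on a category $\mathscr D$ consists of auto-equivalences $\rho_g$ $(g\in G)$ and natural isomorphisms $\theta_{g,h}\colon\rho_g\rho_h\to\rho_{hg}$ with $\theta_{g,kh}\circ\rho_g\theta_{h,k}=\theta_{hg,k}\circ\theta_{g,h}\rho_k$ for all $g,h,k$. The equivariant category $\mathscr D^G$ has as objects the pairs $(X,\chi)$, where $\chi_g\colon X\to\rho_gX$ are isomorphisms with $\theta_{g,h}\circ\rho_g(\chi_h)\circ\chi_g=\chi_{hg}$, and as morphisms the morphisms of $\mathscr D$ that commute with the $\chi_g$; it is abelian if $\mathscr D$ is. A $G$-functor is a functor $F$ between categories with $G$-action together with natural isomorphisms $\sigma_g\colon F\rho_g\to\hat\rho_gF$ with $\sigma_{hg}\circ F\theta_{g,h}=\hat\theta_{g,h}F\circ\hat\rho_g\sigma_h\circ\sigma_g\rho_h$; it induces $F^G\colon(X,\chi)\mapsto(FX,(\sigma_g\circ F\chi_g)_g)$ on equivariant categories. For $k\ge 0$, an exact functor $F\colon\mathscr A\to\mathscr B$ of abelian categories is a $k$-homological embedding if the induced maps $\mathrm{Ext}^n_{\mathscr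 A}(X,Y)\to\mathrm{Ext}^n_{\mathscr B}(FX,FY)$ are bijective for all $X,Y\in\mathscr A$ and $0\le n\le k$. (1) Let $F\colon\mathscr A\to\mathscr B$ be an exact functor between abelian categories with $G$-actions which is a $G$-functor. If $F$ is a $k$-homological embedding, then $F^G\colon\mathscr A^G\to\mathscr B^G$ is a $k$-homological embedding. (2) Let $(\mathscr A,\mathscr B,\mathscr C)$ be a recollement of abelian categories, that is, functors $\mathsf i\colon\mathscr A\to\mathscr B$, $\mathsf q,\mathsf p\colon\mathscr B\to\mathscr A$, $\mathsf e\colon\mathscr B\to\mathscr C$, $\mathsf l,\mathsf r\colon\mathscr C\to\mathscr B$ with adjunctions $\mathsf q\dashv\mathsf i\dashv\mathsf p$ and $\mathsf l\dashv\mathsf e\dashv\mathsf r$, with $\mathsf i,\mathsf l,\mathsf r$ fully faithful, and with the essential image of $\mathsf i$ equal to $\operatorname{Ker}\mathsf e$. Assume that $\mathscr B$ has enough projectives or enough injectives, that $G$ acts on $\mathscr B$ with $|G|$ invertible in $\mathscr B$ (every morphism $f$ is of the form $|G|\cdot f'$), and that the recollement lifts to a $G$-equivariant recollement: either $G$ acts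 on $\mathscr C$ such that $\mathsf e$ is a $G$-functor, or the essential image of $\mathsf i$ is stable under all $\rho_g$. Then there is an induced $G$-action on $\mathscr A$ for which $\mathsf i$ is a $G$-functor, and for every such action and $G$-functor structure, and every $k\ge 0$, the functor $\mathsf i$ is a $k$-homological embedding if and only if $\mathsf i^G\colon\mathscr A^G\to\mathscr B^G$ is a $k$-homological embedding. -/

import Mathlib

open CategoryTheory CategoryTheory.Limits

universe w v u v₁ u₁ v₂ u₂ v₃ u₃

namespace Equivariant

/-- A right action `(ρ, θ)` of a group `G` on a category `D`: autoequivalences `ρ g` and natural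
isomorphisms `θ g h : ρ_g ∘ ρ_h ≅ ρ_{hg}` satisfying the 2-cocycle condition. (Functor composition
`⋙` is written in diagrammatic order; `eqToHom` identifies `ρ_{(kh)g}` with `ρ_{k(hg)}`.) -/
structure RightAction (G : Type w) [Group G] (D : Type u) [Category.{v} D] where
  ρ : G → D ⥤ D
  isEquivalence : ∀ g, (ρ g).IsEquivalence
  θ : ∀ g h, ρ h ⋙ ρ g ≅ ρ (h * g)
  cocycle : ∀ (g h k : G) (X : D),
    (ρ g).map ((θ h k).hom.app X) ≫ (θ g (k * h)).hom.app X ≫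
        eqToHom (by rw [mul_assoc]) =
      (θ g h).hom.app ((ρ k).obj X) ≫ (θ (h * g) k).hom.app X

attribute [instance] RightAction.isEquivalence

/-- An equivariant object `(X, χ)`: an object with a linearization. -/
structure EquivariantObject {G : Type w} [Group G] {D : Type u} [Category.{v} D]
    (α : RightAction G D) where
  obj : D
  χ : ∀ g, obj ≅ (α.ρ g).obj obj
  cocycle : ∀ g h : G,
    (χ g).hom ≫ (α.ρ g).map (χ h).hom ≫ (α.θ g h).hom.app obj = (χ (h * g)).hom

namespace EquivariantObject

section

variable {G : Type w} [Group G] {D : Type u} [Category.{v} D] {α : RightAction G D}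

/-- Morphisms of equivariant objects: morphisms commuting with the linearizations. -/
@[ext]
structure Hom (X Y : EquivariantObject α) where
  hom : X.obj ⟶ Y.obj
  comm : ∀ g : G, (X.χ g).hom ≫ (α.ρ g).map hom = hom ≫ (Y.χ g).hom

/-- The equivariant category `D^G`. -/
instance : Category (EquivariantObject α) where
  Hom X Y := Hom X Y
  id X := ⟨𝟙 X.obj, fun g => by simp⟩
  comp f f' := ⟨f.hom ≫ f'.hom, fun g => by
    rw [Functor.map_comp, ← Category.assoc, f.comm, Category.assoc, f'.comm, Category.assoc]⟩
  id_comp f := Hom.ext (Category.id_comp f.hom)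
  comp_id f := Hom.ext (Category.comp_id f.hom)
  assoc f f' f'' := Hom.ext (Category.assoc f.hom f'.hom f''.hom)

@[ext]
theorem hom_ext {X Y : EquivariantObject α} {f f' : X ⟶ Y} (h : f.hom = f'.hom) : f = f' :=
  Hom.ext h

@[simp]
theorem id_hom (X : EquivariantObject α) : Hom.hom (𝟙 X) = 𝟙 X.obj := rfl

@[simp]
theorem comp_hom {X Y Z : EquivariantObject α} (f : X ⟶ Y) (f' : Y ⟶ Z) :
    (f ≫ f').hom = f.hom ≫ f'.hom := rfl

variable (α) in
/-- The forgetful functor `D^G ⥤ D`. -/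
@[simps]
def forget : EquivariantObject α ⥤ D where
  obj X := X.obj
  map f := f.hom

instance : (forget α).Faithful where
  map_injective h := hom_ext h

instance : (forget α).ReflectsIsomorphisms where
  reflects {X Y} f hf := by
    have hf' : IsIso f.hom := hf
    refine ⟨⟨⟨inv f.hom, fun g => ?_⟩, ?_, ?_⟩⟩
    · rw [Functor.map_inv, IsIso.comp_inv_eq, Category.assoc, IsIso.eq_inv_comp, f.comm]
    · exact hom_ext (IsIso.hom_inv_id f.hom)
    · exact hom_ext (IsIso.inv_hom_id f.hom)

end

section Limits

variable {G : Type w} [Group G] {D : Type u} [Category.{v} D] {α : RightAction G D}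

theorem cocycle_of_legs {P : D} {χ : ∀ g, P ⟶ (α.ρ g).obj P} {X : EquivariantObject α}
    {p : P ⟶ X.obj} (hp : ∀ g, χ g ≫ (α.ρ g).map p = p ≫ (X.χ g).hom) (g h : G) :
    (χ g ≫ (α.ρ g).map (χ h) ≫ (α.θ g h).hom.app P) ≫ (α.ρ (h * g)).map p =
      χ (h * g) ≫ (α.ρ (h * g)).map p := by
  have nat := (α.θ g h).hom.naturality p
  simp only [Functor.comp_map] at nat
  rw [hp, ← X.cocycle, Category.assoc, Category.assoc, ← nat, ← Functor.map_comp_assoc, hp,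
    Functor.map_comp_assoc, ← Category.assoc, hp, Category.assoc]

theorem comm_of_legs {P : D} {χ : ∀ g, P ⟶ (α.ρ g).obj P} {X S : EquivariantObject α}
    {p : P ⟶ X.obj} (hp : ∀ g, χ g ≫ (α.ρ g).map p = p ≫ (X.χ g).hom)
    {l : S.obj ⟶ P} (s : S ⟶ X) (hl : l ≫ p = s.hom) (g : G) :
    ((S.χ g).hom ≫ (α.ρ g).map l) ≫ (α.ρ g).map p = (l ≫ χ g) ≫ (α.ρ g).map p := by
  rw [Category.assoc, Category.assoc, hp, ← Functor.map_comp, reassoc_of% hl, hl, s.comm]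

theorem cocycle_of_colegs {P : D} {χ : ∀ g, P ⟶ (α.ρ g).obj P} {X : EquivariantObject α}
    {p : X.obj ⟶ P} (hp : ∀ g, p ≫ χ g = (X.χ g).hom ≫ (α.ρ g).map p) (g h : G) :
    p ≫ χ g ≫ (α.ρ g).map (χ h) ≫ (α.θ g h).hom.app P = p ≫ χ (h * g) := by
  have nat := (α.θ g h).hom.naturality p
  simp only [Functor.comp_map] at nat
  rw [hp, ← X.cocycle, reassoc_of% (hp g), ← Functor.map_comp_assoc, hp,
    Functor.map_comp_assoc, Category.assoc, Category.assoc, ← nat]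

theorem comm_of_colegs {P : D} {χ : ∀ g, P ⟶ (α.ρ g).obj P} {X S : EquivariantObject α}
    {p : X.obj ⟶ P} (hp : ∀ g, p ≫ χ g = (X.χ g).hom ≫ (α.ρ g).map p)
    {l : P ⟶ S.obj} (s : X ⟶ S) (hl : p ≫ l = s.hom) (g : G) :
    p ≫ χ g ≫ (α.ρ g).map l = p ≫ l ≫ (S.χ g).hom := by
  rw [reassoc_of% (hp g), ← Functor.map_comp, reassoc_of% hl, hl, s.comm]

variable {J : Type u₁} [Category.{v₁} J] (K : J ⥤ EquivariantObject α)

/-- The linearizations of the objects `K.obj j` as a natural isomorphism. -/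
def natIso (g : G) : K ⋙ forget α ≅ (K ⋙ forget α) ⋙ α.ρ g :=
  NatIso.ofComponents (fun j => (K.obj j).χ g) (fun f => ((K.map f).comm g).symm)

/-- The limit of the underlying diagram, with the induced linearization. -/
noncomputable def limitPt (c : Cone (K ⋙ forget α)) (hc : IsLimit c) : EquivariantObject α where
  obj := c.pt
  χ g := hc.conePointsIsoOfNatIso (isLimitOfPreserves (α.ρ g) hc) (natIso K g)
  cocycle g h := (isLimitOfPreserves (α.ρ (h * g)) hc).hom_ext fun j =>
    cocycle_of_legs (X := K.obj j) (fun g =>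
      IsLimit.conePointsIsoOfNatIso_hom_comp hc (isLimitOfPreserves (α.ρ g) hc) (natIso K g) j) g h

theorem limitPt_comp (c : Cone (K ⋙ forget α)) (hc : IsLimit c) (j : J) (g : G) :
    ((limitPt K c hc).χ g).hom ≫ (α.ρ g).map (c.π.app j) = c.π.app j ≫ ((K.obj j).χ g).hom :=
  IsLimit.conePointsIsoOfNatIso_hom_comp hc (isLimitOfPreserves (α.ρ g) hc) (natIso K g) j

noncomputable instance : CreatesLimit K (forget α) :=
  createsLimitOfReflectsIso fun c hc =>
    { liftedCone :=
        { pt := limitPt K c hc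
          π :=
            { app := fun j => ⟨c.π.app j, fun g => limitPt_comp K c hc j g⟩
              naturality := fun _ _ f => hom_ext (c.π.naturality f) } }
      validLift := Cone.ext (Iso.refl _) (fun _ => (Category.id_comp _).symm)
      makesLimit :=
        { lift := fun s => ⟨hc.lift ((forget α).mapCone s), fun g =>
            (isLimitOfPreserves (α.ρ g) hc).hom_ext fun j =>
              comm_of_legs (X := K.obj j) (limitPt_comp K c hc j) (s.π.app j)
                (hc.fac ((forget α).mapCone s) j) g⟩
          fac := fun s j => hom_ext (hc.fac ((forget α).mapCone s) j)
          uniq := fun s m hm => hom_ext (hc.uniq ((forget α).mapCone s) m.hom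
            (fun _ => congrArg Hom.hom (hm _))) } }

/-- The colimit of the underlying diagram, with the induced linearization. -/
noncomputable def colimitPt (c : Cocone (K ⋙ forget α)) (hc : IsColimit c) :
    EquivariantObject α where
  obj := c.pt
  χ g := hc.coconePointsIsoOfNatIso (isColimitOfPreserves (α.ρ g) hc) (natIso K g)
  cocycle g h := hc.hom_ext fun j =>
    cocycle_of_colegs (X := K.obj j) (fun g =>
      IsColimit.comp_coconePointsIsoOfNatIso_hom hc
        (isColimitOfPreserves (α.ρ g) hc) (natIso K g) j) g h

theorem comp_colimitPt (c : Cocone (K ⋙ forget α)) (hc : IsColimit c) (j : J) (g : G) :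
    c.ι.app j ≫ ((colimitPt K c hc).χ g).hom = ((K.obj j).χ g).hom ≫ (α.ρ g).map (c.ι.app j) :=
  IsColimit.comp_coconePointsIsoOfNatIso_hom hc (isColimitOfPreserves (α.ρ g) hc) (natIso K g) j

noncomputable instance : CreatesColimit K (forget α) :=
  createsColimitOfReflectsIso fun c hc =>
    { liftedCocone :=
        { pt := colimitPt K c hc
          ι :=
            { app := fun j => ⟨c.ι.app j, fun g => (comp_colimitPt K c hc j g).symm⟩
              naturality := fun _ _ f => hom_ext (c.ι.naturality f) } }
      validLift := Cocone.ext (Iso.refl _) (fun _ => Category.comp_id _)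
      makesColimit :=
        { desc := fun s => ⟨hc.desc ((forget α).mapCocone s), fun g =>
            hc.hom_ext fun j =>
              comm_of_colegs (X := K.obj j) (comp_colimitPt K c hc j) (s.ι.app j)
                (hc.fac ((forget α).mapCocone s) j) g⟩
          fac := fun s j => hom_ext (hc.fac ((forget α).mapCocone s) j)
          uniq := fun s m hm => hom_ext (hc.uniq ((forget α).mapCocone s) m.hom
            (fun _ => congrArg Hom.hom (hm _))) } }

end Limits

section Abelian

variable {G : Type w} [Group G] {D : Type u} [Category.{v} D] [Abelian D] {α : RightAction G D}

instance (g : G) : (α.ρ g).Additive := (α.ρ g).additive_of_preserves_binary_products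

instance (X Y : EquivariantObject α) : Zero (X ⟶ Y) := ⟨⟨0, fun g => by simp⟩⟩

instance (X Y : EquivariantObject α) : Add (X ⟶ Y) :=
  ⟨fun f f' => ⟨f.hom + f'.hom, fun g => by simp [f.comm, f'.comm]⟩⟩

instance (X Y : EquivariantObject α) : Neg (X ⟶ Y) :=
  ⟨fun f => ⟨-f.hom, fun g => by simp [f.comm]⟩⟩

instance (X Y : EquivariantObject α) : AddCommGroup (X ⟶ Y) where
  add_assoc f f' f'' := hom_ext (add_assoc f.hom f'.hom f''.hom)
  zero_add f := hom_ext (zero_add f.hom)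
  add_zero f := hom_ext (add_zero f.hom)
  add_comm f f' := hom_ext (add_comm f.hom f'.hom)
  neg_add_cancel f := hom_ext (neg_add_cancel f.hom)
  nsmul := nsmulRec
  zsmul := zsmulRec

instance : Preadditive (EquivariantObject α) where
  add_comp _ _ _ f f' f'' := hom_ext (Preadditive.add_comp _ _ _ f.hom f'.hom f''.hom)
  comp_add _ _ _ f f' f'' := hom_ext (Preadditive.comp_add _ _ _ f.hom f'.hom f''.hom)

instance : (forget α).Additive where
  map_add := rfl

instance : HasFiniteLimits (EquivariantObject α) where
  out _ _ _ := ⟨fun K => hasLimit_of_created K (forget α)⟩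

instance : HasFiniteColimits (EquivariantObject α) where
  out _ _ _ := ⟨fun K => hasColimit_of_created K (forget α)⟩

instance : PreservesFiniteLimits (forget α) where
  preservesFiniteLimits _ _ _ := ⟨fun {_} => inferInstance⟩

instance : PreservesFiniteColimits (forget α) where
  preservesFiniteColimits _ _ _ := ⟨fun {_} => inferInstance⟩

instance {X Y : EquivariantObject α} (f : X ⟶ Y) : IsIso (Abelian.coimageImageComparison f) := by
  have h : IsIso ((forget α).map (Abelian.coimageImageComparison f)) :=
    (Arrow.isIso_iff_isIso_of_isIso
      (Abelian.PreservesCoimageImageComparison.iso (forget α) f).inv).1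
        (inferInstanceAs (IsIso (Abelian.coimageImageComparison ((forget α).map f))))
  exact isIso_of_reflects_iso _ (forget α)

/-- The equivariant category of an abelian category is abelian. -/
noncomputable instance : Abelian (EquivariantObject α) :=
  Abelian.ofCoimageImageComparisonIsIso

end Abelian

end EquivariantObject

section Functors

variable {G : Type w} [Group G] {A : Type u₁} [Category.{v₁} A] {B : Type u₂} [Category.{v₂} B]

/-- The structure of a `G`-functor on `F`: natural isomorphisms `σ g : F ∘ ρ_g ≅ ρ'_g ∘ F`
compatible with the composition isomorphisms. -/
structure GFunctorStructure (α : RightAction G A) (β : RightAction G B) (F : A ⥤ B) where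
  σ : ∀ g, α.ρ g ⋙ F ≅ F ⋙ β.ρ g
  assoc : ∀ (g h : G) (X : A),
    F.map ((α.θ g h).hom.app X) ≫ (σ (h * g)).hom.app X =
      (σ g).hom.app ((α.ρ h).obj X) ≫ (β.ρ g).map ((σ h).hom.app X) ≫
        (β.θ g h).hom.app (F.obj X)

/-- The equivariant functor `F^G : A^G ⥤ B^G`, `(X, χ) ↦ (F X, (σ_g ∘ F χ_g)_g)`. -/
def equivariantFunctor {α : RightAction G A} {β : RightAction G B} {F : A ⥤ B}
    (s : GFunctorStructure α β F) : EquivariantObject α ⥤ EquivariantObject β where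
  obj X :=
    { obj := F.obj X.obj
      χ := fun g => F.mapIso (X.χ g) ≪≫ (s.σ g).app X.obj
      cocycle := fun g h => by
        have nat := (s.σ g).hom.naturality (X.χ h).hom
        have e := s.assoc g h X.obj
        simp only [Functor.comp_map] at nat
        simp only [Iso.trans_hom, Functor.mapIso_hom, Iso.app_hom, Functor.map_comp,
          Category.assoc]
        rw [← reassoc_of% nat, ← e, ← X.cocycle g h]
        simp only [Functor.map_comp, Category.assoc] }
  map f := ⟨F.map f.hom, fun g => by
    have nat := (s.σ g).hom.naturality f.hom
    simp only [Functor.comp_map] at nat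
    simp only [Iso.trans_hom, Functor.mapIso_hom, Iso.app_hom, Category.assoc]
    rw [← nat, ← F.map_comp_assoc, f.comm, F.map_comp_assoc]⟩
  map_id X := EquivariantObject.hom_ext (F.map_id X.obj)
  map_comp f f' := EquivariantObject.hom_ext (F.map_comp f.hom f'.hom)

/-- A functor `F` between abelian categories is a `k`-homological embedding if it is exact and the
induced maps `Ext^n(X, Y) → Ext^n(F X, F Y)` are bijective for all `X`, `Y` and `0 ≤ n ≤ k`. -/
def IsHomologicalEmbedding [Abelian A] [Abelian B] (F : A ⥤ B) (k : ℕ) : Prop :=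
  ∃ (_ : F.Additive) (_ : PreservesFiniteLimits F) (_ : PreservesFiniteColimits F),
    haveI : HasExt.{max u₁ v₁} A := HasExt.standard A
    haveI : HasExt.{max u₂ v₂} B := HasExt.standard B
    ∀ (X Y : A) (n : ℕ), n ≤ k → Function.Bijective (F.mapExtAddHom X Y n)

end Functors

/-- `n` is invertible in a preadditive category: every morphism is divisible by `n`. -/
def IsInvertibleIn (n : ℕ) (D : Type u) [Category.{v} D] [Preadditive D] : Prop :=
  ∀ (X Y : D) (f : X ⟶ Y), ∃ f' : X ⟶ Y, f = n • f'

/-- A recollement of abelian categories. -/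
structure AbelianRecollement (A : Type u₁) [Category.{v₁} A] [Abelian A]
    (B : Type u₂) [Category.{v₂} B] [Abelian B]
    (C : Type u₃) [Category.{v₃} C] [Abelian C] where
  i : A ⥤ B
  q : B ⥤ A
  p : B ⥤ A
  e : B ⥤ C
  l : C ⥤ B
  r : C ⥤ B
  adjQI : q ⊣ i
  adjIP : i ⊣ p
  adjLE : l ⊣ e
  adjER : e ⊣ r
  i_full : i.Full
  i_faithful : i.Faithful
  l_full : l.Full
  l_faithful : l.Faithful
  r_full : r.Full
  r_faithful : r.Faithful
  image_eq_kernel : ∀ Y : B, i.essImage Y ↔ IsZero (e.obj Y)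

/-- The recollement lifts to a `G`-equivariant recollement along an action on `B`: either `G` acts
on `C` such that `e` is a `G`-functor, or `A` (i.e. the essential image of `i`) is a `G`-invariant
subcategory of `B`. -/
def AbelianRecollement.LiftsToEquivariant {G : Type w} [Group G]
    {A : Type u₁} [Category.{v₁} A] [Abelian A]
    {B : Type u₂} [Category.{v₂} B] [Abelian B]
    {C : Type u₃} [Category.{v₃} C] [Abelian C]
    (R : AbelianRecollement A B C) (β : RightAction G B) : Prop :=
  (∃ γ : RightAction G C, Nonempty (GFunctorStructure β γ R.e)) ∨
    ∀ (g : G) (X : A), R.i.essImage ((β.ρ g).obj (R.i.obj X))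

end Equivariant

/-!
The forgetful functor `D^G ⥤ D` has the right adjoint `Y ↦ ∏ ρ_h Y`, coinduction. Both functors are
exact and `F^G` commutes with coinduction, so the comparison map of `F^G` on the extensions of an
equivariant object `W` by the object coinduced from `Y` is identified with the comparison map of `F`
on the extensions of `W.obj` by `Y`. Since every equivariant object embeds into a coinduced one,
dimension shifting passes bijectivity from `F` to `F^G`. Conversely, each object `Y` is the natural
direct summand `ρ_1 Y` of the object coinduced from it, so `F` is a retract of coinduction followed
by `F^G` and the forgetful functor, and exactness and bijectivity descend from `F^G` to `F`.
-/

namespace Equivariant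

open EquivariantObject CategoryTheory.Abelian

universe t t₁ t₂ t₃

section Effacement

variable {C : Type u} [Category.{v} C] [Abelian C]

lemma epi_f_zero_of_quasiIso_single {X : C} {K : CochainComplex C ℤ}
    (s : K ⟶ (HomologicalComplex.single C (ComplexShape.up ℤ) 0).obj X) [QuasiIso s] :
    Epi (s.f 0) := by
  let L := (HomologicalComplex.single C (ComplexShape.up ℤ) 0).obj X
  have isZero_L {i : ℤ} (hi : i ≠ 0) : IsZero (L.X i) :=
    HomologicalComplex.isZero_single_obj_X _ _ _ _ hi
  have : IsIso (L.homologyπ 0) :=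
    L.isIso_homologyπ (-1) 0 (by simp) ((isZero_L (by simp)).eq_of_src _ _)
  have : IsIso (L.iCycles 0) := L.isIso_iCycles 0 1 (by simp) ((isZero_L (by simp)).eq_of_tgt _ _)
  have : Epi (HomologicalComplex.cyclesMap s 0) := by
    have : Epi (HomologicalComplex.cyclesMap s 0 ≫ L.homologyπ 0) := by
      rw [← HomologicalComplex.homologyπ_naturality]
      infer_instance
    simpa using epi_comp (HomologicalComplex.cyclesMap s 0 ≫ L.homologyπ 0) (inv (L.homologyπ 0))
  have : Epi (K.iCycles 0 ≫ s.f 0) := by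
    rw [← HomologicalComplex.cyclesMap_i]
    exact epi_comp _ (L.iCycles 0)
  exact epi_of_epi (K.iCycles 0) (s.f 0)

open DerivedCategory in
lemma exists_epi_Q_map_single_map_comp_eq_zero [HasDerivedCategory.{t} C] {X : C}
    {L : CochainComplex C ℤ} (hL : IsZero (L.X 0))
    (x : Q.obj ((HomologicalComplex.single C (ComplexShape.up ℤ) 0).obj X) ⟶ Q.obj L) :
    ∃ (P : C) (p : P ⟶ X),
      Epi p ∧ Q.map ((HomologicalComplex.single C (ComplexShape.up ℤ) 0).map p) ≫ x = 0 := by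
  obtain ⟨K, _, s, hs, g, rfl⟩ := right_fac_of_isStrictlyLE x 0
  have : QuasiIso s := by rwa [← isIso_Q_map_iff_quasiIso]
  have := epi_f_zero_of_quasiIso_single s
  let j : (HomologicalComplex.single C (ComplexShape.up ℤ) 0).obj (K.X 0) ⟶ K :=
    HomologicalComplex.mkHomFromSingle (𝟙 _) fun k hk =>
      (K.isZero_of_isStrictlyLE 0 k (by rw [ComplexShape.up_Rel] at hk; lia)).eq_of_tgt _ _
  let e : ((HomologicalComplex.single C (ComplexShape.up ℤ) 0).obj X).X 0 ≅ X :=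
    HomologicalComplex.singleObjXSelf (ComplexShape.up ℤ) 0 X
  have j_comp_s :
      j ≫ s = (HomologicalComplex.single C (ComplexShape.up ℤ) 0).map (s.f 0 ≫ e.hom) :=
    HomologicalComplex.from_single_hom_ext
      (by simp [j, e, HomologicalComplex.single_map_f_self])
  have j_comp_g : j ≫ g = 0 :=
    HomologicalComplex.from_single_hom_ext (hL.eq_of_tgt _ _)
  refine ⟨K.X 0, s.f 0 ≫ e.hom, epi_comp _ _, ?_⟩
  rw [← j_comp_s, Functor.map_comp, Category.assoc, IsIso.hom_inv_id_assoc, ← Functor.map_comp,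
    j_comp_g, Functor.map_zero]

lemma exists_epi_mk₀_comp_eq_zero [HasExt.{t} C] {X Y : C} {n : ℕ} (x : Ext X Y (n + 1)) :
    ∃ (P : C) (p : P ⟶ X), Epi p ∧ (Ext.mk₀ p).comp x (zero_add _) = 0 := by
  let := HasDerivedCategory.standard C
  let Y' := (HomologicalComplex.single C (ComplexShape.up ℤ) 0).obj Y
  let e : DerivedCategory.Q.obj (Y'⟦((n + 1 : ℕ) : ℤ)⟧) ≅
      (DerivedCategory.Q.obj Y')⟦((n + 1 : ℕ) : ℤ)⟧ :=
    (DerivedCategory.Q.commShiftIso ((n + 1 : ℕ) : ℤ)).app Y'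
  have isZero_shift : IsZero ((Y'⟦((n + 1 : ℕ) : ℤ)⟧).X 0) :=
    (HomologicalComplex.isZero_single_obj_X _ _ _ (0 + ((n + 1 : ℕ) : ℤ)) (by lia)).of_iso
      (CochainComplex.shiftFunctorObjXIso Y' _ 0 _ rfl)
  obtain ⟨P, p, hp, hpx⟩ :=
    exists_epi_Q_map_single_map_comp_eq_zero isZero_shift (x.hom ≫ e.inv)
  refine ⟨P, p, hp, ?_⟩
  ext
  rw [← Ext.singleFunctor_map_comp_hom, Ext.zero_hom]
  exact (Preadditive.IsIso.comp_right_eq_zero _ e.inv).1 ((Category.assoc _ _ _).trans hpx)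

lemma induction_on_extClass [HasExt.{t} C]
    {motive : ∀ {X Y : C} {n : ℕ}, Ext X Y n → Prop}
    (zero : ∀ {X Y : C} (f : X ⟶ Y), motive (Ext.mk₀ f))
    (succ : ∀ {S : ShortComplex C} (hS : S.ShortExact) {Y : C} {n : ℕ} (y : Ext S.X₁ Y n),
      motive y → motive (hS.extClass.comp y (add_comm 1 n)))
    {X Y : C} {n : ℕ} (x : Ext X Y n) : motive x := by
  induction n generalizing X with
  | zero =>
    obtain ⟨f, rfl⟩ := (Ext.mk₀_bijective X Y).2 x
    exact zero f
  | succ n ih =>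
    obtain ⟨P, p, _, hp⟩ := exists_epi_mk₀_comp_eq_zero x
    have hS : (ShortComplex.mk _ _ (kernel.condition p)).ShortExact :=
      { exact := ShortComplex.exact_kernel p }
    obtain ⟨y, rfl⟩ := Ext.contravariant_sequence_exact₃ hS Y x hp (add_comm 1 n)
    exact succ hS y (ih y)

end Effacement

section ExactFunctors

variable {C : Type u₁} [Category.{v₁} C] [Abelian C] {D : Type u₂} [Category.{v₂} D] [Abelian D]
  {E : Type u₃} [Category.{v₃} E] [Abelian E] [HasExt.{t₁} C] [HasExt.{t₂} D] [HasExt.{t₃} E]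

lemma mapExactFunctor_id {X Y : C} {n : ℕ} (x : Ext X Y n) : x.mapExactFunctor (𝟭 C) = x := by
  induction x using induction_on_extClass with
  | zero f => exact Ext.mapExactFunctor_mk₀ (𝟭 C) f
  | succ hS y ih =>
    rw [Ext.mapExactFunctor_comp, ih]
    exact congrArg (Ext.comp · y _) (Ext.mapExactFunctor_extClass (𝟭 C) hS)

lemma mapExactFunctor_mapExactFunctor (F : C ⥤ D) [F.Additive] [PreservesFiniteLimits F]
    [PreservesFiniteColimits F] (F' : D ⥤ E) [F'.Additive] [PreservesFiniteLimits F']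
    [PreservesFiniteColimits F'] {X Y : C} {n : ℕ} (x : Ext X Y n) :
    (x.mapExactFunctor F).mapExactFunctor F' = x.mapExactFunctor (F ⋙ F') := by
  induction x using induction_on_extClass with
  | zero f => simp only [Ext.mapExactFunctor_mk₀]; rfl
  | succ hS y ih =>
    rw [Ext.mapExactFunctor_comp, Ext.mapExactFunctor_comp, Ext.mapExactFunctor_comp, ih,
      Ext.mapExactFunctor_extClass]
    exact congrArg (Ext.comp · _ _) ((Ext.mapExactFunctor_extClass F' (hS.map_of_exact F)).trans
      (Ext.mapExactFunctor_extClass (F ⋙ F') hS).symm)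

lemma mk₀_app_comp_mapExactFunctor {F F' : C ⥤ D}
    [F.Additive] [PreservesFiniteLimits F] [PreservesFiniteColimits F]
    [F'.Additive] [PreservesFiniteLimits F'] [PreservesFiniteColimits F']
    (τ : F ⟶ F') {X Y : C} {n : ℕ} (x : Ext X Y n) :
    (Ext.mk₀ (τ.app X)).comp (x.mapExactFunctor F') (zero_add n) =
      (x.mapExactFunctor F).comp (Ext.mk₀ (τ.app Y)) (add_zero n) := by
  induction x using induction_on_extClass with
  | zero f => simp only [Ext.mapExactFunctor_mk₀, Ext.mk₀_comp_mk₀, τ.naturality]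
  | @succ S hS Y n y ih =>
    have extClass_naturality :
        (Ext.mk₀ (τ.app S.X₃)).comp (hS.extClass.mapExactFunctor F') (zero_add 1) =
          (hS.extClass.mapExactFunctor F).comp (Ext.mk₀ (τ.app S.X₁)) (add_zero 1) := by
      rw [Ext.mapExactFunctor_extClass, Ext.mapExactFunctor_extClass]
      exact ((hS.map_of_exact F).extClass_naturality (hS.map_of_exact F') (S.mapNatTrans τ)).symm
    rw [Ext.mapExactFunctor_comp, Ext.mapExactFunctor_comp, Ext.comp_assoc_of_third_deg_zero, ← ih,
      ← Ext.comp_assoc_of_second_deg_zero, ← extClass_naturality,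
      Ext.comp_assoc (a₁₂ := 1) (a₂₃ := n + 1) _ _ _ _ _ (by lia)]

end ExactFunctors

section Adjunction

variable {C : Type u₁} [Category.{v₁} C] [Abelian C] {D : Type u₂} [Category.{v₂} D] [Abelian D]
  [HasExt.{t₁} C] [HasExt.{t₂} D] {L : C ⥤ D} {R : D ⥤ C} (adj : L ⊣ R)
  [L.Additive] [PreservesFiniteLimits L] [PreservesFiniteColimits L]
  [R.Additive] [PreservesFiniteLimits R] [PreservesFiniteColimits R]

lemma mk₀_unit_comp_mapExactFunctor {X Y : C} {n : ℕ} (x : Ext X Y n) :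
    (Ext.mk₀ (adj.unit.app X)).comp ((x.mapExactFunctor L).mapExactFunctor R) (zero_add n) =
      x.comp (Ext.mk₀ (adj.unit.app Y)) (add_zero n) := by
  have naturality := mk₀_app_comp_mapExactFunctor adj.unit x
  rw [mapExactFunctor_id] at naturality
  rw [mapExactFunctor_mapExactFunctor]
  exact naturality

lemma mapExactFunctor_comp_mk₀_counit {X Y : D} {n : ℕ} (y : Ext X Y n) :
    ((y.mapExactFunctor R).mapExactFunctor L).comp (Ext.mk₀ (adj.counit.app Y)) (add_zero n) =
      (Ext.mk₀ (adj.counit.app X)).comp y (zero_add n) := by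
  have naturality := mk₀_app_comp_mapExactFunctor adj.counit y
  rw [mapExactFunctor_id] at naturality
  rw [mapExactFunctor_mapExactFunctor]
  exact naturality.symm

lemma bijective_mapExactFunctor_comp_counit (X : C) (Y : D) (n : ℕ) :
    Function.Bijective fun x : Ext X (R.obj Y) n =>
      (x.mapExactFunctor L).comp (Ext.mk₀ (adj.counit.app Y)) (add_zero n) := by
  refine Function.bijective_iff_has_inverse.2
    ⟨fun y => (Ext.mk₀ (adj.unit.app X)).comp (Ext.mapExactFunctor R (Y := Y) y) (zero_add n),
      fun x => ?_, fun (y : Ext (L.obj X) Y n) => ?_⟩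
  · dsimp only
    rw [Ext.mapExactFunctor_comp, Ext.mapExactFunctor_mk₀, ← Ext.comp_assoc_of_third_deg_zero,
      mk₀_unit_comp_mapExactFunctor, Ext.comp_assoc_of_third_deg_zero, Ext.mk₀_comp_mk₀,
      adj.right_triangle_components, Ext.comp_mk₀_id]
  · dsimp only
    rw [Ext.mapExactFunctor_comp, Ext.mapExactFunctor_mk₀, Ext.comp_assoc_of_third_deg_zero,
      mapExactFunctor_comp_mk₀_counit, Ext.mk₀_comp_mk₀_assoc, adj.left_triangle_components,
      Ext.mk₀_id_comp]

end Adjunction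

section ExtComparison

variable {C : Type u₁} [Category.{v₁} C] [Abelian C] {D : Type u₂} [Category.{v₂} D] [Abelian D]
  [HasExt.{t₁} C] [HasExt.{t₂} D]
  (F : C ⥤ D) [F.Additive] [PreservesFiniteLimits F] [PreservesFiniteColimits F]

lemma bijective_mapExtAddHom_zero_iff (X Y : C) :
    Function.Bijective (F.mapExtAddHom X Y 0) ↔ Function.Bijective (F.map : (X ⟶ Y) → _) := by
  simp [Ext.mapExactFunctor₀]

lemma postcomp_comp_mapExtAddHom {X Y Z : C} {m n n' : ℕ} {y : Ext Y Z m}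
    {y' : Ext (F.obj Y) (F.obj Z) m} (hy : y.mapExactFunctor F = y') (hn : n + m = n') :
    (y'.postcomp (F.obj X) hn).comp (F.mapExtAddHom X Y n) =
      (F.mapExtAddHom X Z n').comp (y.postcomp X hn) := by
  ext x
  simp [← hy, Ext.mapExactFunctor_comp]

lemma injective_mapExtAddHom_succ {S : ShortComplex C} (hS : S.ShortExact) (X : C) {n : ℕ}
    (h₂ : Function.Surjective (F.mapExtAddHom X S.X₂ n))
    (h₃ : Function.Injective (F.mapExtAddHom X S.X₃ n))
    (h₂' : Function.Injective (F.mapExtAddHom X S.X₂ (n + 1))) :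
    Function.Injective (F.mapExtAddHom X S.X₁ (n + 1)) :=
  AddMonoidHom.injective_of_surjective_of_injective_of_injective _ _ _ _ _
    ((Ext.mk₀ (F.map S.f)).postcomp (F.obj X) (add_zero (n + 1))) _ _
    (F.mapExtAddHom X S.X₁ (n + 1)) _
    (postcomp_comp_mapExtAddHom F (Ext.mapExactFunctor_mk₀ ..) _)
    (postcomp_comp_mapExtAddHom F (Ext.mapExactFunctor_extClass ..) _)
    (postcomp_comp_mapExtAddHom F (Ext.mapExactFunctor_mk₀ ..) _)
    ((ShortComplex.ab_exact_iff_function_exact _).1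
      (Ext.covariant_sequence_exact₃' X hS n (n + 1) rfl))
    ((ShortComplex.ab_exact_iff_function_exact _).1
      (Ext.covariant_sequence_exact₁' X hS n (n + 1) rfl))
    ((ShortComplex.ab_exact_iff_function_exact _).1
      (Ext.covariant_sequence_exact₃' (F.obj X) (hS.map_of_exact F) n (n + 1) rfl))
    h₂ h₃ h₂'

lemma surjective_mapExtAddHom_succ {S : ShortComplex C} (hS : S.ShortExact) (X : C) {n : ℕ}
    (h₃ : Function.Surjective (F.mapExtAddHom X S.X₃ n))
    (h₂' : Function.Surjective (F.mapExtAddHom X S.X₂ (n + 1)))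
    (h₃' : Function.Injective (F.mapExtAddHom X S.X₃ (n + 1))) :
    Function.Surjective (F.mapExtAddHom X S.X₁ (n + 1)) :=
  AddMonoidHom.surjective_of_surjective_of_surjective_of_injective
    (hS.extClass.postcomp X rfl) _ _ _ _ _ _ (F.mapExtAddHom X S.X₁ (n + 1)) _ _
    (postcomp_comp_mapExtAddHom F (Ext.mapExactFunctor_extClass ..) _)
    (postcomp_comp_mapExtAddHom F (Ext.mapExactFunctor_mk₀ ..) _)
    (postcomp_comp_mapExtAddHom F (Ext.mapExactFunctor_mk₀ ..) _)
    ((ShortComplex.ab_exact_iff_function_exact _).1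
      (Ext.covariant_sequence_exact₂' X hS (n + 1)))
    ((ShortComplex.ab_exact_iff_function_exact _).1
      (Ext.covariant_sequence_exact₁' (F.obj X) (hS.map_of_exact F) n (n + 1) rfl))
    ((ShortComplex.ab_exact_iff_function_exact _).1
      (Ext.covariant_sequence_exact₂' (F.obj X) (hS.map_of_exact F) (n + 1)))
    h₃ h₂' h₃'

lemma comp_mk₀_retract {X X' Y : C} (r : Retract X X') {n : ℕ} (x : Ext X Y n) :
    (Ext.mk₀ r.i).comp ((Ext.mk₀ r.r).comp x (zero_add n)) (zero_add n) = x := by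
  rw [Ext.mk₀_comp_mk₀_assoc, r.retract, Ext.mk₀_id_comp]

lemma bijective_mapExtAddHom_of_retract {X X' Y : C} (r : Retract X X') {n : ℕ}
    (h : Function.Bijective (F.mapExtAddHom X' Y n)) :
    Function.Bijective (F.mapExtAddHom X Y n) := by
  constructor
  · intro x y hxy
    have : (Ext.mk₀ r.r).comp x (zero_add n) = (Ext.mk₀ r.r).comp y (zero_add n) :=
      h.injective (by simp_all [Ext.mapExactFunctor_comp])
    rw [← comp_mk₀_retract r x, this, comp_mk₀_retract]
  · intro y
    obtain ⟨x, hx⟩ := h.surjective ((Ext.mk₀ (r.map F).r).comp y (zero_add n))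
    refine ⟨(Ext.mk₀ r.i).comp x (zero_add n), ?_⟩
    rw [Functor.mapExtAddHom_coe] at hx ⊢
    rw [Ext.mapExactFunctor_comp, hx, Ext.mapExactFunctor_mk₀]
    exact comp_mk₀_retract (r.map F) y

end ExtComparison

section Retracts

lemma exact_of_retract {C : Type u} [Category.{v} C] [HasZeroMorphisms C] {S T : ShortComplex C}
    [S.HasHomology] [T.HasHomology] (r : Retract S T) (hT : T.Exact) : S.Exact := by
  rw [ShortComplex.exact_iff_isZero_homology] at hT ⊢
  rw [IsZero.iff_id_eq_zero, ← ShortComplex.homologyMap_id, ← r.retract,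
    ShortComplex.homologyMap_comp, hT.eq_of_tgt (ShortComplex.homologyMap r.i) 0, zero_comp]

lemma additive_of_retract {C : Type u₁} [Category.{v₁} C] [Preadditive C] {D : Type u₂}
    [Category.{v₂} D] [Preadditive D] {F H : C ⥤ D} (r : Retract F H) [H.Additive] :
    F.Additive where
  map_add {X Y f f'} := by
    have map_eq (f : X ⟶ Y) : F.map f = r.i.app X ≫ H.map f ≫ r.r.app Y := by
      rw [← r.i.naturality_assoc, ← NatTrans.comp_app, r.retract, NatTrans.id_app,
        Category.comp_id]
    simp only [map_eq, H.map_add, Preadditive.add_comp, Preadditive.comp_add]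

variable {C : Type u₁} [Category.{v₁} C] [Abelian C] {D : Type u₂} [Category.{v₂} D] [Abelian D]

lemma preservesFiniteLimits_and_colimits_of_retract {F H : C ⥤ D} (r : Retract F H) [H.Additive]
    [F.Additive] [PreservesFiniteLimits H] [PreservesFiniteColimits H] :
    PreservesFiniteLimits F ∧ PreservesFiniteColimits F :=
  have map_exact (S : ShortComplex C) (hS : S.Exact) : (S.map F).Exact :=
    exact_of_retract
      { i := S.mapNatTrans r.i
        r := S.mapNatTrans r.r
        retract := by ext <;> exact NatTrans.congr_app r.retract _ }
      (hS.map H)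
  (F.exact_tfae.out 1 3).1 map_exact

end Retracts

section Unit

variable {G : Type w} [Group G] {D : Type u} [Category.{v} D] (α : RightAction G D)

namespace RightAction

/-- The isomorphism `ρ_1 ≅ 𝟭`, obtained from `θ_{1,1} : ρ_1 ∘ ρ_1 ≅ ρ_1` by cancelling the
equivalence `ρ_1`. -/
noncomputable def unitIso : α.ρ 1 ≅ 𝟭 D :=
  Functor.fullyFaithfulCancelRight (α.ρ 1)
    (α.θ 1 1 ≪≫ eqToIso (by rw [one_mul]; rfl))

lemma θ_hom_naturality (g h : G) {X Y : D} (f : X ⟶ Y) :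
    (α.ρ g).map ((α.ρ h).map f) ≫ (α.θ g h).hom.app Y =
      (α.θ g h).hom.app X ≫ (α.ρ (h * g)).map f :=
  (α.θ g h).hom.naturality f

lemma map_unitIso_hom_app (g : G) (X : D) :
    (α.ρ g).map (α.unitIso.hom.app X) =
      (α.θ g 1).hom.app X ≫ eqToHom (by rw [one_mul]; rfl) := by
  have map_eqToHom_comp_θ (g : G) {a b : G} (h : a = b) :
      (α.ρ g).map (eqToHom (by rw [h])) ≫ (α.θ g b).hom.app X =
        (α.θ g a).hom.app X ≫ eqToHom (by rw [h]) := by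
    subst h
    simp
  have map_one : (α.ρ 1).map (α.unitIso.hom.app X) =
      (α.θ 1 1).hom.app X ≫ eqToHom (by rw [one_mul]; rfl) := by
    simp [unitIso, eqToHom_app]
  obtain ⟨g, rfl⟩ : ∃ g', g = 1 * g' := ⟨g, (one_mul g).symm⟩
  have cocycle := α.cocycle g 1 1 X
  rw [← cancel_epi ((α.θ g 1).hom.app ((α.ρ 1).obj X)), ← reassoc_of% cocycle,
    ← α.θ_hom_naturality, map_one, Functor.map_comp, Category.assoc]
  simp [map_eqToHom_comp_θ g (one_mul (1 : G))]

end RightAction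

lemma EquivariantObject.χ_one_hom_comp_unitIso {α : RightAction G D} (X : EquivariantObject α) :
    (X.χ 1).hom ≫ α.unitIso.hom.app X.obj = 𝟙 X.obj := by
  have χ_comp_eqToHom {a b : G} (h : a = b) :
      (X.χ a).hom ≫ eqToHom (by rw [h]) = (X.χ b).hom := by
    subst h
    simp
  apply (α.ρ 1).map_injective
  rw [Functor.map_comp, α.map_unitIso_hom_app, ← cancel_epi (X.χ 1).hom, reassoc_of% X.cocycle,
    CategoryTheory.Functor.map_id, Category.comp_id]
  exact χ_comp_eqToHom (one_mul 1)

end Unit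

section Coinduction

variable {G : Type w} [Group G] {D : Type u} [Category.{v} D] [HasProductsOfShape G D]
  (α : RightAction G D)

/-- The linearization of `∏ ρ_h Y`: the `h`-th component of `χ_g : ∏ ρ_h Y ≅ ρ_g (∏ ρ_h Y)` is the
projection to `ρ_{hg} Y ≅ ρ_g ρ_h Y`. -/
noncomputable def coinducedχ (Y : D) (g : G) :
    (∏ᶜ fun h => (α.ρ h).obj Y) ≅ (α.ρ g).obj (∏ᶜ fun h => (α.ρ h).obj Y) :=
  (PreservesProduct.iso (α.ρ g) (fun h => (α.ρ h).obj Y) ≪≫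
    Pi.whiskerEquiv (Equiv.mulRight g) fun h => ((α.θ g h).app Y).symm).symm

lemma coinducedχ_hom_comp_map_π (Y : D) (g h : G) :
    (coinducedχ α Y g).hom ≫ (α.ρ g).map (Pi.π _ h) = Pi.π _ (h * g) ≫ (α.θ g h).inv.app Y := by
  change (Pi.map' (f := fun h => (α.ρ h).obj Y) (g := fun h => (α.ρ g).obj ((α.ρ h).obj Y))
    (· * g) (fun h => (α.θ g h).inv.app Y) ≫ (PreservesProduct.iso (α.ρ g) _).inv) ≫ _ = _
  have iso_inv_comp_map_π : (PreservesProduct.iso (α.ρ g) fun h => (α.ρ h).obj Y).inv ≫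
      (α.ρ g).map (Pi.π _ h) = Pi.π _ h := by
    rw [Iso.inv_comp_eq, PreservesProduct.iso_hom, piComparison_comp_π]
  rw [Category.assoc, iso_inv_comp_map_π]
  exact Pi.map'_comp_π ..

lemma coinducedχ_hom_comp_map_π_comp_θ (Y : D) (g h : G) :
    (coinducedχ α Y g).hom ≫ (α.ρ g).map (Pi.π _ h) ≫ (α.θ g h).hom.app Y = Pi.π _ (h * g) := by
  rw [reassoc_of% coinducedχ_hom_comp_map_π, Iso.inv_hom_id_app, Category.comp_id]

variable {α} in
lemma hom_ext_map_π_comp_θ {W Y : D} {g : G} {f f' : W ⟶ (α.ρ g).obj (∏ᶜ fun h => (α.ρ h).obj Y)}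
    (w : ∀ h, f ≫ (α.ρ g).map (Pi.π _ h) ≫ (α.θ g h).hom.app Y =
      f' ≫ (α.ρ g).map (Pi.π _ h) ≫ (α.θ g h).hom.app Y) : f = f' := by
  rw [← cancel_mono (piComparison (α.ρ g) _)]
  refine Pi.hom_ext _ _ fun h => ?_
  rw [← cancel_mono ((α.θ g h).hom.app Y)]
  simpa using w h

/-- The equivariant object coinduced from `Y`: the product of the objects `ρ_h Y`. -/
noncomputable abbrev coinduced (Y : D) : EquivariantObject α where
  obj := ∏ᶜ fun h => (α.ρ h).obj Y
  χ := coinducedχ α Y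
  cocycle g h := hom_ext_map_π_comp_θ fun k => by
    simp only [Category.assoc, coinducedχ_hom_comp_map_π_comp_θ]
    rw [← reassoc_of% α.θ_hom_naturality, ← α.cocycle, ← Functor.map_comp_assoc,
      ← Functor.map_comp_assoc, Category.assoc, coinducedχ_hom_comp_map_π_comp_θ,
      reassoc_of% coinducedχ_hom_comp_map_π_comp_θ]
    exact Pi.π_comp_eqToHom (fun h => (α.ρ h).obj Y) (mul_assoc k h g)

/-- The projection of a coinduced object to the factor `ρ_1 Y ≅ Y`. -/
noncomputable def coinducedCounit (Y : D) : (coinduced α Y).obj ⟶ Y :=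
  Pi.π _ 1 ≫ α.unitIso.hom.app Y

lemma coinduced_χ_hom_comp_map_counit (Y : D) (h : G) :
    ((coinduced α Y).χ h).hom ≫ (α.ρ h).map (coinducedCounit α Y) = Pi.π _ h := by
  rw [coinducedCounit, Functor.map_comp, α.map_unitIso_hom_app]
  simp only [coinduced, reassoc_of% coinducedχ_hom_comp_map_π_comp_θ]
  exact Pi.π_comp_eqToHom (fun h => (α.ρ h).obj Y) (one_mul h)

variable {α} in
/-- The equivariant morphism into a coinduced object induced by a morphism to `Y`. -/
noncomputable def coinducedLift {W : EquivariantObject α} {Y : D} (f : W.obj ⟶ Y) :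
    W ⟶ coinduced α Y where
  hom := Pi.lift fun h => (W.χ h).hom ≫ (α.ρ h).map f
  comm g := hom_ext_map_π_comp_θ fun h => by
    simp only [Category.assoc, coinduced, coinducedχ_hom_comp_map_π_comp_θ]
    rw [← Functor.map_comp_assoc, Pi.lift_π, Pi.lift_π, Functor.map_comp_assoc, α.θ_hom_naturality,
      reassoc_of% (W.cocycle g h)]

variable {α} in
lemma coinducedLift_hom_comp_counit {W : EquivariantObject α} {Y : D} (f : W.obj ⟶ Y) :
    (coinducedLift f).hom ≫ coinducedCounit α Y = f := by
  simp [coinducedLift, coinducedCounit, α.unitIso.hom.naturality,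
    reassoc_of% W.χ_one_hom_comp_unitIso]

variable {α} in
lemma coinducedLift_of_hom_comp_counit {W : EquivariantObject α} {Y : D}
    (φ : W ⟶ coinduced α Y) : coinducedLift (φ.hom ≫ coinducedCounit α Y) = φ :=
  EquivariantObject.hom_ext <| Pi.hom_ext _ _ fun h => by
    refine (Pi.lift_π _ h).trans ?_
    rw [Functor.map_comp, reassoc_of% φ.comm h, coinduced_χ_hom_comp_map_counit]

instance {W : EquivariantObject α} {Y : D} (f : W.obj ⟶ Y) [Mono f] : Mono (coinducedLift f) :=
  have : Mono ((coinducedLift f).hom ≫ coinducedCounit α Y) := by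
    rwa [coinducedLift_hom_comp_counit]
  (forget α).mono_of_mono_map (mono_of_mono (coinducedLift f).hom (coinducedCounit α Y))

instance (Y : D) : IsIso (coinducedLift (coinducedCounit α Y)) := by
  have lift_counit := coinducedLift_of_hom_comp_counit (𝟙 (coinduced α Y))
  rw [id_hom, Category.id_comp] at lift_counit
  rw [lift_counit]
  infer_instance

/-- Frobenius reciprocity: morphisms `W.obj ⟶ Y` correspond to equivariant morphisms to the object
coinduced from `Y`. -/
noncomputable def coinducedHomEquiv (W : EquivariantObject α) (Y : D) :
    ((forget α).obj W ⟶ Y) ≃ (W ⟶ coinduced α Y) where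
  toFun := coinducedLift
  invFun φ := φ.hom ≫ coinducedCounit α Y
  left_inv := coinducedLift_hom_comp_counit
  right_inv := coinducedLift_of_hom_comp_counit

/-- The right adjoint `Y ↦ ∏ ρ_h Y` of the forgetful functor of the equivariant category. -/
noncomputable def coinduction : D ⥤ EquivariantObject α :=
  Adjunction.rightAdjointOfEquiv (F := forget α) (coinducedHomEquiv α) fun X' X Y f g => by
    apply (coinducedHomEquiv α X' Y).symm.injective
    rw [Equiv.symm_apply_apply]
    exact (congrArg (_ ≫ ·) ((coinducedHomEquiv α X Y).symm_apply_apply g)).symm.trans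
      (Category.assoc ..).symm

/-- Coinduction is right adjoint to the forgetful functor. -/
noncomputable def forgetCoinductionAdjunction : forget α ⊣ coinduction α :=
  Adjunction.adjunctionOfEquivRight _ _

lemma forgetCoinductionAdjunction_counit_app (Y : D) :
    (forgetCoinductionAdjunction α).counit.app Y = coinducedCounit α Y := by
  change 𝟙 _ ≫ coinducedCounit α Y = _
  rw [Category.id_comp]

lemma coinduction_map_hom {Y Z : D} (p : Y ⟶ Z) :
    ((coinduction α).map p).hom = Limits.Pi.map fun h => (α.ρ h).map p :=
  Pi.hom_ext _ _ fun h => by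
    have map_eq_lift : (coinduction α).map p =
        coinducedLift ((𝟙 _ ≫ coinducedCounit α Y) ≫ p) := rfl
    rw [map_eq_lift, Category.id_comp]
    refine (Pi.lift_π _ h).trans ?_
    rw [Functor.map_comp, reassoc_of% coinduced_χ_hom_comp_map_counit α Y h]
    exact (Limits.Pi.map_π (fun h => (α.ρ h).map p) h).symm

end Coinduction

section DirectSummand

variable {G : Type w} [Group G] {D : Type u} [Category.{v} D] [HasProductsOfShape G D]
  [HasZeroMorphisms D] (α : RightAction G D)

open scoped Classical in
/-- The inclusion of `Y ≅ ρ_1 Y` as a factor of the object coinduced from `Y`. -/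
noncomputable def coinducedInclusion (Y : D) : Y ⟶ (coinduced α Y).obj :=
  α.unitIso.inv.app Y ≫ Pi.ι (fun h => (α.ρ h).obj Y) 1

lemma coinducedInclusion_comp_counit (Y : D) :
    coinducedInclusion α Y ≫ coinducedCounit α Y = 𝟙 Y := by
  classical
  rw [coinducedInclusion, coinducedCounit, Category.assoc, Pi.ι_π_eq_id_assoc]
  exact α.unitIso.inv_hom_id_app Y

lemma coinducedInclusion_naturality {Y Z : D} (p : Y ⟶ Z) :
    p ≫ coinducedInclusion α Z =
      coinducedInclusion α Y ≫ Limits.Pi.map fun h => (α.ρ h).map p := by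
  classical
  refine Pi.hom_ext _ _ fun h => ?_
  rcases eq_or_ne 1 h with rfl | hh
  · simpa [coinducedInclusion] using α.unitIso.inv.naturality p
  · simp [coinducedInclusion, Pi.ι_π_of_ne, reassoc_of% Pi.ι_π_of_ne, hh]

/-- Every object is naturally a direct summand of the object coinduced from it. -/
noncomputable def coinductionRetract : Retract (𝟭 D) (coinduction α ⋙ forget α) where
  i :=
    { app := coinducedInclusion α
      naturality _ _ p := (coinducedInclusion_naturality α p).trans
        (congrArg (_ ≫ ·) (coinduction_map_hom α p).symm) }
  r := (forgetCoinductionAdjunction α).counit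
  retract := by
    ext Y
    exact (congrArg (_ ≫ ·) (forgetCoinductionAdjunction_counit_app α Y)).trans
      (coinducedInclusion_comp_counit α Y)

end DirectSummand

section CoinductionAbelian

variable {G : Type w} [Group G] [Finite G] {D : Type u} [Category.{v} D] [Abelian D]
  (α : RightAction G D)

instance : (coinduction α).Additive :=
  (forgetCoinductionAdjunction α).right_adjoint_additive

instance : PreservesFiniteLimits (coinduction α) where
  preservesFiniteLimits _ _ _ :=
    have := (forgetCoinductionAdjunction α).rightAdjoint_preservesLimits
    inferInstance

instance : (coinduction α).PreservesEpimorphisms where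
  preserves {Y Z} p _ := by
    have : HasFiniteBiproducts D := HasFiniteBiproducts.of_hasFiniteProducts
    apply (forget α).epi_of_epi_map
    have : Epi (Limits.Pi.map fun h => (α.ρ h).map p) := inferInstance
    rwa [← coinduction_map_hom] at this

instance : PreservesFiniteColimits (coinduction α) :=
  have := (coinduction α).preservesHomology_of_preservesEpis_and_kernels
  (coinduction α).preservesFiniteColimits_of_preservesHomology

end CoinductionAbelian

section ExtCoinduced

lemma bijective_comp_mk₀ {C : Type u} [Category.{v} C] [Abelian C] [HasExt.{t} C] (X : C) {Y Z : C}
    (f : Y ⟶ Z) [IsIso f] (n : ℕ) :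
    Function.Bijective fun x : Ext X Y n => x.comp (Ext.mk₀ f) (add_zero n) :=
  Function.bijective_iff_has_inverse.2
    ⟨fun y => y.comp (Ext.mk₀ (inv f)) (add_zero n), fun x => by simp, fun y => by simp⟩

variable {G : Type w} [Group G] [Finite G] {D : Type u} [Category.{v} D] [Abelian D]
  {α : RightAction G D} [HasExt.{t} D] [HasExt.{t₁} (EquivariantObject α)]

lemma bijective_mapExactFunctor_forget_comp (W : EquivariantObject α) {J : EquivariantObject α}
    {Y : D} (ε : J.obj ⟶ Y) [IsIso (coinducedLift ε)] (n : ℕ) :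
    Function.Bijective fun x : Ext.{t₁} W J n =>
      (x.mapExactFunctor (forget α) : Ext.{t} W.obj J.obj n).comp (Ext.mk₀ ε) (add_zero n) := by
  have comp_bijective :=
    (bijective_mapExactFunctor_comp_counit (forgetCoinductionAdjunction α) W Y n).comp
      (bijective_comp_mk₀ W (coinducedLift ε) n)
  refine (congrArg Function.Bijective (funext fun x => ?_)).mp comp_bijective
  change ((x.comp (Ext.mk₀ (coinducedLift ε)) (add_zero n)).mapExactFunctor (forget α)).comp
    (Ext.mk₀ _) (add_zero n) = _
  rw [Ext.mapExactFunctor_comp, Ext.mapExactFunctor_mk₀, Ext.comp_assoc_of_third_deg_zero,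
    forgetCoinductionAdjunction_counit_app]
  refine congrArg (Ext.comp _ · (add_zero n)) ((Ext.mk₀_comp_mk₀ _ _).trans ?_)
  exact congrArg Ext.mk₀ (coinducedLift_hom_comp_counit ε)

end ExtCoinduced

section ReflectsLimits

variable {G : Type w} [Group G] {D : Type u} [Category.{v} D] {α : RightAction G D}

instance [HasFiniteLimits D] : ReflectsFiniteLimits (forget α) where
  reflects _ _ _ := ⟨fun {K} =>
    have : HasLimit K := hasLimit_of_created K (forget α)
    reflectsLimit_of_reflectsIsomorphisms K (forget α)⟩

instance [HasFiniteColimits D] : ReflectsFiniteColimits (forget α) where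
  reflects _ _ _ := ⟨fun {K} =>
    have : HasColimit K := hasColimit_of_created K (forget α)
    reflectsColimit_of_reflectsIsomorphisms K (forget α)⟩

end ReflectsLimits

section EquivariantFunctor

variable {G : Type w} [Group G] {A : Type u₁} [Category.{v₁} A] {B : Type u₂} [Category.{v₂} B]
  {α : RightAction G A} {β : RightAction G B} {F : A ⥤ B} (s : GFunctorStructure α β F)

lemma χ_hom_comp_map_ρ_map {W : EquivariantObject α} {Y : A} (f : W.obj ⟶ Y) (h : G) :
    (((equivariantFunctor s).obj W).χ h).hom ≫ (β.ρ h).map (F.map f) =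
      F.map ((W.χ h).hom ≫ (α.ρ h).map f) ≫ (s.σ h).hom.app Y := by
  have nat := (s.σ h).hom.naturality f
  simp only [Functor.comp_map] at nat
  simp [equivariantFunctor, nat]

lemma bijective_map_equivariantFunctor
    (hF : ∀ X Y : A, Function.Bijective (F.map : (X ⟶ Y) → _)) (X Y : EquivariantObject α) :
    Function.Bijective ((equivariantFunctor s).map : (X ⟶ Y) → _) := by
  refine ⟨fun f f' h => EquivariantObject.hom_ext ((hF _ _).1 (congrArg Hom.hom h)), fun f => ?_⟩
  obtain ⟨p, hp⟩ := (hF X.obj Y.obj).2 f.hom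
  refine ⟨⟨p, fun h => (hF _ _).1 ?_⟩, EquivariantObject.hom_ext hp⟩
  have comm := f.comm h
  rw [← hp] at comm
  rw [← cancel_mono ((s.σ h).hom.app Y.obj), ← χ_hom_comp_map_ρ_map]
  refine comm.trans ?_
  rw [F.map_comp, Category.assoc]
  rfl

section Coinduction

variable [HasProductsOfShape G A] [HasProductsOfShape G B]

/-- The comparison morphism from `F` of the object coinduced from `Y` to the object coinduced from
`F Y`. -/
noncomputable def coinducedComparison (Y : A) :
    F.obj (∏ᶜ fun h => (α.ρ h).obj Y) ⟶ ∏ᶜ fun h => (β.ρ h).obj (F.obj Y) :=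
  Pi.lift fun h => F.map (Pi.π _ h) ≫ (s.σ h).hom.app Y

lemma coinducedLift_map_hom {J : EquivariantObject α} {Y : A} (ε : J.obj ⟶ Y) :
    (coinducedLift (W := (equivariantFunctor s).obj J) (F.map ε)).hom =
      F.map (coinducedLift ε).hom ≫ coinducedComparison s Y := by
  refine Pi.hom_ext _ _ fun h => ?_
  have rhs_comp_π : (F.map (coinducedLift ε).hom ≫ coinducedComparison s Y) ≫ Pi.π _ h =
      F.map ((J.χ h).hom ≫ (α.ρ h).map ε) ≫ (s.σ h).hom.app Y := by
    rw [coinducedComparison, Category.assoc, Pi.lift_π, ← Functor.map_comp_assoc, coinducedLift,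
      Pi.lift_π]
  exact (Pi.lift_π _ h).trans ((χ_hom_comp_map_ρ_map s ε h).trans rhs_comp_π.symm)

variable [PreservesLimitsOfShape (Discrete G) F]

instance (Y : A) : IsIso (coinducedComparison s Y) := by
  let e : F.obj (∏ᶜ fun h => (α.ρ h).obj Y) ≅ ∏ᶜ fun h => (β.ρ h).obj (F.obj Y) :=
    PreservesProduct.iso F _ ≪≫ Pi.mapIso fun h => (s.σ h).app Y
  have comparison_eq : coinducedComparison s Y = e.hom :=
    Pi.hom_ext _ _ fun h => by simp [coinducedComparison, e]
  rw [comparison_eq]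
  infer_instance

instance {J : EquivariantObject α} {Y : A} (ε : J.obj ⟶ Y) [IsIso (coinducedLift ε)] :
    IsIso (coinducedLift (W := (equivariantFunctor s).obj J) (F.map ε)) := by
  have : IsIso (coinducedLift ε).hom := inferInstanceAs (IsIso ((forget α).map (coinducedLift ε)))
  have isIso_hom : IsIso (F.map (coinducedLift ε).hom ≫ coinducedComparison s Y) := inferInstance
  rw [← coinducedLift_map_hom] at isIso_hom
  have : IsIso ((forget β).map (coinducedLift (W := (equivariantFunctor s).obj J) (F.map ε))) :=
    isIso_hom
  exact isIso_of_reflects_iso (coinducedLift _) (forget β)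

end Coinduction

end EquivariantFunctor

section ExactEquivariantFunctor

variable {G : Type w} [Group G] {A : Type u₁} [Category.{v₁} A] [Abelian A]
  {B : Type u₂} [Category.{v₂} B] [Abelian B] {α : RightAction G A} {β : RightAction G B}
  {F : A ⥤ B} (s : GFunctorStructure α β F)

instance [F.Additive] : (equivariantFunctor s).Additive where
  map_add := EquivariantObject.hom_ext F.map_add

instance [PreservesFiniteLimits F] : PreservesFiniteLimits (equivariantFunctor s) :=
  have : PreservesFiniteLimits (equivariantFunctor s ⋙ forget β) :=
    inferInstanceAs (PreservesFiniteLimits (forget α ⋙ F))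
  preservesFiniteLimits_of_reflects_of_preserves _ (forget β)

instance [PreservesFiniteColimits F] : PreservesFiniteColimits (equivariantFunctor s) :=
  have : PreservesFiniteColimits (equivariantFunctor s ⋙ forget β) :=
    inferInstanceAs (PreservesFiniteColimits (forget α ⋙ F))
  preservesFiniteColimits_of_reflects_of_preserves _ (forget β)

variable [Finite G]

/-- A `G`-functor `F` is a retract of the composite of coinduction, `F^G` and the forgetful
functor, by the direct summand `Y` of the object coinduced from `Y`. -/
noncomputable def retractCoinductionEquivariantFunctor :
    Retract F (coinduction α ⋙ equivariantFunctor s ⋙ forget β) :=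
  (coinductionRetract α).map ((Functor.whiskeringRight _ _ _).obj F)

lemma exact_of_exact_equivariantFunctor [(equivariantFunctor s).Additive]
    [PreservesFiniteLimits (equivariantFunctor s)]
    [PreservesFiniteColimits (equivariantFunctor s)] :
    F.Additive ∧ PreservesFiniteLimits F ∧ PreservesFiniteColimits F :=
  have retract := retractCoinductionEquivariantFunctor s
  have additive := additive_of_retract retract
  ⟨additive, preservesFiniteLimits_and_colimits_of_retract retract⟩

section Ext

variable [F.Additive] [PreservesFiniteLimits F] [PreservesFiniteColimits F]
  [HasExt.{t} A] [HasExt.{t₁} (EquivariantObject α)]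
  [HasExt.{t₂} B] [HasExt.{t₃} (EquivariantObject β)]

lemma bijective_mapExtAddHom_equivariantFunctor_iff {W J : EquivariantObject α} {Y : A}
    (ε : J.obj ⟶ Y) [IsIso (coinducedLift ε)] (n : ℕ) :
    Function.Bijective ((equivariantFunctor s).mapExtAddHom W J n :
      Ext.{t₁} _ _ n →+ Ext.{t₃} _ _ n) ↔
    Function.Bijective (F.mapExtAddHom W.obj Y n : Ext.{t} _ _ n →+ Ext.{t₂} _ _ n) := by
  have adjunct_A := bijective_mapExactFunctor_forget_comp (D := A) W ε n
  have adjunct_B := bijective_mapExactFunctor_forget_comp (D := B)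
    ((equivariantFunctor s).obj W) (J := (equivariantFunctor s).obj J) (F.map ε) n
  have compatible (x : Ext.{t₁} W J n) :
      ((x.mapExactFunctor (equivariantFunctor s) : Ext.{t₃} _ _ n).mapExactFunctor
        (forget β) : Ext.{t₂} _ _ n).comp (Ext.mk₀ (F.map ε)) (add_zero n) =
      ((x.mapExactFunctor (forget α) : Ext.{t} W.obj J.obj n).comp
        (Ext.mk₀ ε) (add_zero n)).mapExactFunctor F := by
    refine Eq.trans ?_ ((Ext.mapExactFunctor_comp F _ _ _).trans
      (congrArg (Ext.comp _ · (add_zero n)) (Ext.mapExactFunctor_mk₀ F ε))).symm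
    exact congrArg (Ext.comp · (Ext.mk₀ (F.map ε)) (add_zero n))
      ((mapExactFunctor_mapExactFunctor (equivariantFunctor s) (forget β) x).trans
        (mapExactFunctor_mapExactFunctor (forget α) F x).symm)
  exact (Function.Bijective.of_comp_iff' adjunct_B _).symm.trans
    ((congrArg Function.Bijective (funext compatible)).to_iff.trans
      (Function.Bijective.of_comp_iff _ adjunct_A))

theorem bijective_mapExtAddHom_equivariantFunctor {k : ℕ}
    (hF : ∀ (X Y : A) (n : ℕ), n ≤ k →
      Function.Bijective (F.mapExtAddHom X Y n : Ext.{t} _ _ n →+ Ext.{t₂} _ _ n))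
    (X Y : EquivariantObject α) (n : ℕ) (hn : n ≤ k) :
    Function.Bijective ((equivariantFunctor s).mapExtAddHom X Y n :
      Ext.{t₁} _ _ n →+ Ext.{t₃} _ _ n) := by
  induction n generalizing Y with
  | zero =>
    rw [bijective_mapExtAddHom_zero_iff]
    exact bijective_map_equivariantFunctor s
      (fun X Y => (bijective_mapExtAddHom_zero_iff F X Y).1 (hF X Y 0 (Nat.zero_le k))) X Y
  | succ n ih =>
    replace ih (Y) := ih Y (by lia)
    have coinduced_case (Z : A) :
        Function.Bijective ((equivariantFunctor s).mapExtAddHom X (coinduced α Z) (n + 1) :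
          Ext.{t₁} _ _ (n + 1) →+ Ext.{t₃} _ _ (n + 1)) :=
      (bijective_mapExtAddHom_equivariantFunctor_iff s (coinducedCounit α Z) (n + 1)).2
        (hF X.obj Z (n + 1) hn)
    let η (Y : EquivariantObject α) : Y ⟶ coinduced α Y.obj := coinducedLift (𝟙 Y.obj)
    have coinduction_sequence (Y) :
        (ShortComplex.mk (η Y) _ (cokernel.condition (η Y))).ShortExact :=
      { exact := ShortComplex.exact_cokernel (η Y) }
    have injective (Y) : Function.Injective ((equivariantFunctor s).mapExtAddHom X Y (n + 1) :
        Ext.{t₁} _ _ (n + 1) →+ Ext.{t₃} _ _ (n + 1)) :=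
      injective_mapExtAddHom_succ (equivariantFunctor s) (coinduction_sequence Y) X
        (ih _).2 (ih _).1 (coinduced_case Y.obj).1
    exact ⟨injective Y, surjective_mapExtAddHom_succ (equivariantFunctor s)
      (coinduction_sequence Y) X (ih _).2 (coinduced_case Y.obj).2 (injective _)⟩

lemma bijective_mapExtAddHom_of_equivariantFunctor {X Y : A} {n : ℕ}
    (h : Function.Bijective
      ((equivariantFunctor s).mapExtAddHom (coinduced α X) (coinduced α Y) n :
        Ext.{t₁} _ _ n →+ Ext.{t₃} _ _ n)) :
    Function.Bijective (F.mapExtAddHom X Y n : Ext.{t} _ _ n →+ Ext.{t₂} _ _ n) :=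
  bijective_mapExtAddHom_of_retract F
    (show Retract X (coinduced α X).obj from
      (coinductionRetract α).map ((evaluation A A).obj X))
    ((bijective_mapExtAddHom_equivariantFunctor_iff s (coinducedCounit α Y) n).1 h)

end Ext

theorem isHomologicalEmbedding_equivariantFunctor_iff (k : ℕ) :
    IsHomologicalEmbedding F k ↔ IsHomologicalEmbedding (equivariantFunctor s) k := by
  let := HasExt.standard A
  let := HasExt.standard B
  let := HasExt.standard (EquivariantObject α)
  let := HasExt.standard (EquivariantObject β)
  constructor
  · rintro ⟨_, _, _, bijective⟩
    exact ⟨inferInstance, inferInstance, inferInstance,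
      bijective_mapExtAddHom_equivariantFunctor s bijective⟩
  · rintro ⟨_, _, _, bijective⟩
    obtain ⟨_, _, _⟩ := exact_of_exact_equivariantFunctor s
    exact ⟨inferInstance, inferInstance, inferInstance, fun X Y n hn =>
      bijective_mapExtAddHom_of_equivariantFunctor s (bijective _ _ n hn)⟩

end ExactEquivariantFunctor

section InducedAction

variable {G : Type w} [Group G] {A : Type u₁} [Category.{v₁} A] {B : Type u₂} [Category.{v₂} B]

namespace RightAction

variable {β : RightAction G B} {i : A ⥤ B} [i.Full] [i.Faithful]
  (hi : ∀ (g : G) (X : A), i.essImage ((β.ρ g).obj (i.obj X)))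

/-- The functor `ρ_g` of the action induced on `A` along a fully faithful functor `i : A ⥤ B`
with stable essential image. -/
noncomputable def inducedρ (g : G) : A ⥤ A :=
  Functor.essImage.liftFunctor (i ⋙ β.ρ g) i (hi g)

/-- The isomorphisms `i ρ_g ≅ ρ_g i` making `i` a `G`-functor for the induced action. -/
noncomputable def inducedσ (g : G) : inducedρ hi g ⋙ i ≅ i ⋙ β.ρ g :=
  Functor.essImage.liftFunctorCompIso (i ⋙ β.ρ g) i (hi g)

lemma inducedσ_hom_naturality (g : G) {X Y : A} (f : X ⟶ Y) :
    i.map ((inducedρ hi g).map f) ≫ (inducedσ hi g).hom.app Y =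
      (inducedσ hi g).hom.app X ≫ (β.ρ g).map (i.map f) :=
  (inducedσ hi g).hom.naturality f

instance (g : G) : (inducedρ hi g).IsEquivalence where
  faithful := (inducedσ hi g).faithful_of_comp
  full := Functor.Full.of_comp_faithful_iso (inducedσ hi g)
  essSurj := ⟨fun Y => by
    let X := (hi g⁻¹ Y).witness
    let iX_iso : i.obj X ≅ (β.ρ g⁻¹).obj (i.obj Y) := (hi g⁻¹ Y).getIso
    let ρ_inv_iso : (β.ρ g).obj ((β.ρ g⁻¹).obj (i.obj Y)) ≅ i.obj Y :=
      (β.θ g g⁻¹ ≪≫ eqToIso (by rw [inv_mul_cancel]) ≪≫ β.unitIso).app (i.obj Y)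
    exact ⟨X, ⟨i.preimageIso ((inducedσ hi g).app X ≪≫ (β.ρ g).mapIso iX_iso ≪≫ ρ_inv_iso)⟩⟩⟩

/-- The composition isomorphisms of the induced action. -/
noncomputable def inducedθ (g h : G) : inducedρ hi h ⋙ inducedρ hi g ≅ inducedρ hi (h * g) :=
  Functor.fullyFaithfulCancelRight i
    (Functor.isoWhiskerLeft (inducedρ hi h) (inducedσ hi g) ≪≫
      Functor.isoWhiskerRight (inducedσ hi h) (β.ρ g) ≪≫
        Functor.isoWhiskerLeft i (β.θ g h) ≪≫ (inducedσ hi (h * g)).symm)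

lemma map_inducedθ_hom_comp_inducedσ (g h : G) (X : A) :
    i.map ((inducedθ hi g h).hom.app X) ≫ (inducedσ hi (h * g)).hom.app X =
      (inducedσ hi g).hom.app ((inducedρ hi h).obj X) ≫
        (β.ρ g).map ((inducedσ hi h).hom.app X) ≫ (β.θ g h).hom.app (i.obj X) := by
  simp [inducedθ]

lemma map_eqToHom_comp_inducedσ {a b : G} (h : a = b) (X : A) :
    i.map (eqToHom (by rw [h]) : (inducedρ hi a).obj X ⟶ (inducedρ hi b).obj X) ≫
      (inducedσ hi b).hom.app X = (inducedσ hi a).hom.app X ≫ eqToHom (by rw [h]) := by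
  subst h
  simp

/-- The action induced on `A` along a fully faithful functor `i : A ⥤ B` with stable essential
image. -/
noncomputable def induced : RightAction G A where
  ρ := inducedρ hi
  isEquivalence := inferInstance
  θ := inducedθ hi
  cocycle g h k X := by
    apply i.map_injective
    rw [← cancel_mono ((inducedσ hi (k * (h * g))).hom.app X)]
    simp only [Functor.map_comp, Category.assoc]
    rw [map_inducedθ_hom_comp_inducedσ, map_eqToHom_comp_inducedσ hi (mul_assoc k h g),
      reassoc_of% (map_inducedθ_hom_comp_inducedσ hi g (k * h) X),
      reassoc_of% (inducedσ_hom_naturality hi g),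
      reassoc_of% (map_inducedθ_hom_comp_inducedσ hi g h),
      ← reassoc_of% (β.θ_hom_naturality g h)]
    simp only [Functor.comp_obj]
    rw [← β.cocycle, ← Functor.map_comp_assoc, map_inducedθ_hom_comp_inducedσ, Functor.map_comp,
      Functor.map_comp]
    simp only [Category.assoc]

/-- The `G`-functor structure on `i` for the induced action. -/
noncomputable def inducedGFunctorStructure : GFunctorStructure (induced hi) β i where
  σ := inducedσ hi
  assoc := map_inducedθ_hom_comp_inducedσ hi

end RightAction

end InducedAction

lemma AbelianRecollement.LiftsToEquivariant.essImage_ρ_obj {G : Type w} [Group G]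
    {A : Type u₁} [Category.{v₁} A] [Abelian A] {B : Type u₂} [Category.{v₂} B] [Abelian B]
    {C : Type u₃} [Category.{v₃} C] [Abelian C] {R : AbelianRecollement A B C}
    {β : RightAction G B} (lifts : R.LiftsToEquivariant β) (g : G) (X : A) :
    R.i.essImage ((β.ρ g).obj (R.i.obj X)) := by
  rcases lifts with ⟨γ, ⟨s⟩⟩ | stable
  · rw [R.image_eq_kernel]
    have isZero : IsZero (R.e.obj (R.i.obj X)) :=
      (R.image_eq_kernel _).1 (R.i.obj_mem_essImage X)
    exact ((γ.ρ g).map_isZero isZero).of_iso ((s.σ g).app (R.i.obj X))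
  · exact stable g X

end Equivariant

theorem mainTheorem6_general {G : Type w} [Group G] [Finite G]
    {A : Type u₁} [Category.{v₁} A] [Abelian A] {B : Type u₂} [Category.{v₂} B] [Abelian B]
    (β : Equivariant.RightAction G B) (k : ℕ) :
    (∀ (α : Equivariant.RightAction G A) (F : A ⥤ B)
        (s : Equivariant.GFunctorStructure α β F),
        Equivariant.IsHomologicalEmbedding F k ↔
          Equivariant.IsHomologicalEmbedding (Equivariant.equivariantFunctor s) k) ∧
    ∀ (i : A ⥤ B) [i.Full] [i.Faithful],
      (∀ (g : G) (X : A), i.essImage ((β.ρ g).obj (i.obj X))) →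
        ∃ α : Equivariant.RightAction G A, Nonempty (Equivariant.GFunctorStructure α β i) :=
  ⟨fun _ _ s => Equivariant.isHomologicalEmbedding_equivariantFunctor_iff s k,
    fun _ _ _ hi => ⟨.induced hi, ⟨Equivariant.RightAction.inducedGFunctorStructure hi⟩⟩⟩

theorem mainTheorem6 (G : Type w) [Group G] [Finite G]
    (A : Type u₁) [Category.{v₁} A] [Abelian A]
    (B : Type u₂) [Category.{v₂} B] [Abelian B]
    (β : Equivariant.RightAction G B) (k : ℕ) :
    -- for every exact `G`-functor, being a `k`-homological embedding passes to `F^G`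
    (∀ (α : Equivariant.RightAction G A) (F : A ⥤ B)
        (s : Equivariant.GFunctorStructure α β F),
        Equivariant.IsHomologicalEmbedding F k →
          Equivariant.IsHomologicalEmbedding (Equivariant.equivariantFunctor s) k) ∧
    -- for recollements that lift to a `G`-equivariant recollement, `A` has an induced action
    -- making `i` a `G`-functor, and `i` is a `k`-homological embedding if and only if `i^G` is
    (∀ (C : Type u₃) [Category.{v₃} C] [Abelian C]
        (R : Equivariant.AbelianRecollement A B C),
        (EnoughProjectives B ∨ EnoughInjectives B) →
        Equivariant.IsInvertibleIn (Nat.card G) B →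
        R.LiftsToEquivariant β →
        (∃ α : Equivariant.RightAction G A,
          Nonempty (Equivariant.GFunctorStructure α β R.i)) ∧
        ∀ (α : Equivariant.RightAction G A)
          (s : Equivariant.GFunctorStructure α β R.i),
          Equivariant.IsHomologicalEmbedding R.i k ↔
            Equivariant.IsHomologicalEmbedding (Equivariant.equivariantFunctor s) k) := by
  obtain ⟨embedding_iff, exists_action⟩ := mainTheorem6_general (A := A) β k
  exact ⟨fun α F s => (embedding_iff α F s).1, fun C _ _ R _ _ lifts =>
    have := R.i_full
    have := R.i_faithful
    ⟨exists_action R.i lifts.essImage_ρ_obj, fun α s => embedding_iff α R.i s⟩⟩
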